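/- Let $\sigma:\mathbb R\to\mathbb R$ be continuous and not of the form $x\mapsto sx+t$. A multilayer perceptron (MLP) is a composition of affine maps between spaces $\mathbb R^a$, with $\sigma$ applied entrywise after each affine map but the last. For $g\in S_n$ and $X\in\mathbb R^{n\times n\times a}$ let $(g\cdot X)_{i_1,i_2,j}=X_{g^{-1}(i_1),g^{-1}(i_2),j}$. **Model.** A network on $\mathbb R^{n\times n\times a}$ is a map $F=m\circ h\circ B_d\circ\cdots\circ B_1$, $d\ge 1$, where $m$ is an MLP, $h:\mathbb R^{n\times n\times c}\to\mathbb R^{c'}$ is a linear map with $h(g\cdot X)=h(X)$ for all $g\in S_n$ and all $X$, and each block $B_i$ is given by three MLPs $m_1,m_2:\mathbb R^{a_i}\to\mathbb R^{b_i}$ and $m_3:\mathbb R^{a_i}\to\mathbb R^{b_i'}$. Applying MLPs to the feature vector at every pair of indices, $m_l(X)_{i_1,i_2,:}=m_l(X_{i_1,i_2,:})$, the block maps $X$ to the concatenation $(m_3(X),W)$, where $W_{:,:,j}=m_1(X)_{:,:,j}\cdot m_2(X)_{:,:,j}$ (product of $n\times n$ matrices) for $j\in[b_i]$. **Graphs.**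 A graph $G=(V,E,d)$ is a simple undirected graph on $n$ vertices $v_1,\dots,v_n$ with vertex colours $d:V\to\mathbb R^e$. It is represented by the tensor $\mathbf B\in\mathbb R^{n\times n\times(e+2)}$ whose first $e$ channels are zero off the diagonal with $\mathbf B_{i,i,1:e}=d(v_i)$, whose channel $e+1$ is the adjacency matrix and whose channel $e+2$ is the identity matrix; $F(G)$ means $F(\mathbf B)$. Two graphs are isomorphic if there is a bijection of their vertices that preserves edges, non-edges and colours. **3-WL.** The test colours the triples $i=(i_1,i_2,i_3)$ of vertices. The initial colour $C^0_i$ is the isomorphism type of the triple: which of its entries are equal, the colours of its entries, and which of its entries are adjacent. The update is $C^l_i=\mathrm{enc}\big(C^{l-1}_i,(\{\!\{C^{l-1}_j : j\in N_r(i)\}\!\})_{r=1,2,3}\big)$, where $\mathrm{enc}$ is injective, $\{\!\{\cdot\}\!\}$ denotes a multiset and $N_r(i)$ consists of the $n$ triples obtained by replacing the $r$-th entry of $i$ by any vertex. It distinguishes $G$ and $G'$ if for some $l$ the multisets of the colours $C^l$ of all triples differ. **Theorem.** Let $G=(V,E,d)$ and $G'=(V',E',d')$ be two graphs as above, both with $n$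 vertices. 1. If $G$ and $G'$ are distinguished by 3-WL, then there is a network $F$ with $F(G)\ne F(G')$, for all enumerations of the vertices of the two graphs. 2. If $G$ and $G'$ are isomorphic, then $F(G)=F(G')$ for every network $F$ and all enumerations of the vertices. 3. Every network is invariant: $F(g\cdot X)=F(X)$ for all $g\in S_n$ and all $X\in\mathbb R^{n\times n\times a}$. -/

import Mathlib

namespace WLNet

/-! ### Coloured graphs -/

/-- A (finite, simple, undirected) graph `G = (V, E, d)` with vertex colours `d : V → S`. -/
structure ColoredGraph (V : Type*) (S : Type) where
  /-- the edges -/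
  graph : SimpleGraph V
  /-- the vertex colouring `d` -/
  color : V → S

/-- Two coloured graphs are isomorphic if there is an edge and colour preserving bijection of
their vertices. -/
def ColoredGraph.Isomorphic {V V' : Type*} {S : Type}
    (G : ColoredGraph V S) (G' : ColoredGraph V' S) : Prop :=
  ∃ φ : G.graph ≃g G'.graph, ∀ v, G'.color (φ v) = G.color v

/-! ### The `k`-WL graph isomorphism test -/

/-- The isomorphism type of a `k`-tuple of vertices of a coloured graph. -/
structure IsoType (k : ℕ) (S : Type) where
  /-- which entries of the tuple are equal -/
  eqPattern : Fin k → Fin k → Prop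
  /-- the colours of the entries of the tuple -/
  color : Fin k → S
  /-- which entries of the tuple are joined by an edge -/
  adj : Fin k → Fin k → Prop

/-- The colours available after `l` rounds of `k`-WL. The injective encoding of a pair (old colour,
`k` multisets of old colours) as a new colour is the pair itself. -/
def WLColor (k : ℕ) (S : Type) : ℕ → Type
  | 0 => IsoType k S
  | l + 1 => WLColor k S l × (Fin k → Multiset (WLColor k S l))

/-- The colouring of the `k`-tuples of vertices after `l` rounds of `k`-WL. The `j`-th
neighbourhood of a tuple `i` consists of the tuples obtained by replacing the `j`-th entry of `i`
by any vertex. -/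
def wlColoring {V : Type*} [Fintype V] {S : Type} (k : ℕ) (G : ColoredGraph V S) :
    (l : ℕ) → (Fin k → V) → WLColor k S l
  | 0, i =>
    { eqPattern := fun q r => i q = i r
      color := fun q => G.color (i q)
      adj := fun q r => G.graph.Adj (i q) (i r) }
  | l + 1, i =>
    (wlColoring k G l i,
      fun j => (Finset.univ : Finset V).val.map
        fun w => wlColoring k G l (Function.update i j w))

/-- The histogram (multiset) of the colours of all `k`-tuples after `l` rounds of `k`-WL. -/
def wlHistogram {V : Type*} [Fintype V] {S : Type} (k : ℕ) (G : ColoredGraph V S) (l : ℕ) :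
    Multiset (WLColor k S l) :=
  (Finset.univ : Finset (Fin k → V)).val.map (wlColoring k G l)

/-- The `k`-WL test distinguishes `G` and `G'` if their colour histograms differ after some number
of rounds (and hence after every larger number of rounds, as colours are only ever refined). -/
def WLDistinguishes {V V' : Type*} [Fintype V] [Fintype V'] {S : Type} (k : ℕ)
    (G : ColoredGraph V S) (G' : ColoredGraph V' S) : Prop :=
  ∃ l : ℕ, wlHistogram k G l ≠ wlHistogram k G' l

/-! ### Tensors -/

/-- Tensors in `ℝ^{n × n × a}`: a vector of `a` features at every pair of indices. -/
abbrev Tensor (n a : ℕ) : Type := Fin n → Fin n → Fin a → ℝ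

/-- The action of the permutation group on tensors,
`(g · X)_{i₁, i₂, j} = X_{g⁻¹(i₁), g⁻¹(i₂), j}`. -/
def permute {n a : ℕ} (g : Equiv.Perm (Fin n)) (X : Tensor n a) : Tensor n a :=
  fun i₁ i₂ => X (g⁻¹ i₁) (g⁻¹ i₂)

open Classical in
/-- The input tensor in `ℝ^{n × n × (e + 2)}` that represents a graph with vertex colours in `ℝ^e`,
for an enumeration `ν` of its vertices: the first `e` channels hold the vertex colours on the
diagonal and vanish outside of it, then come the adjacency matrix and the identity matrix. -/
noncomputable def inputTensor {V : Type*} {n e : ℕ} (G : ColoredGraph V (Fin e → ℝ))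
    (ν : Fin n ≃ V) : Tensor n (e + 2) :=
  fun i₁ i₂ => Fin.append
    (fun c : Fin e => if i₁ = i₂ then G.color (ν i₁) c else 0)
    ![if G.graph.Adj (ν i₁) (ν i₂) then 1 else 0, if i₁ = i₂ then 1 else 0]

/-! ### The network -/

/-- Multilayer perceptrons with `a` inputs and `b` outputs, given by the weight matrices and bias
vectors of their layers. -/
inductive MLP : ℕ → ℕ → Type
  /-- the output layer, `x ↦ W x + c` -/
  | output {a b : ℕ} (W : Matrix (Fin b) (Fin a) ℝ) (c : Fin b → ℝ) : MLP a b
  /-- a hidden layer, `x ↦ σ (W x + c)` with `σ` entrywise, followed by the remaining layers -/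
  | hidden {a w b : ℕ} (W : Matrix (Fin w) (Fin a) ℝ) (c : Fin w → ℝ) (rest : MLP w b) : MLP a b

/-- The function computed by a multilayer perceptron with activation function `σ`. -/
def MLP.eval (σ : ℝ → ℝ) : {a b : ℕ} → MLP a b → (Fin a → ℝ) → (Fin b → ℝ)
  | _, _, .output W c, x => W.mulVec x + c
  | _, _, .hidden W c rest, x => rest.eval σ (fun i => σ ((W.mulVec x + c) i))

/-- A block with `a` input channels and `b' + b` output channels: three multilayer perceptrons. -/
structure Block (a b b' : ℕ) where
  /-- the first factor of the matrix multiplication -/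
  m₁ : MLP a b
  /-- the second factor of the matrix multiplication -/
  m₂ : MLP a b
  /-- the skip connection -/
  m₃ : MLP a b'

/-- The tensor `(m₃(X), W)` computed by a block from `X`. The perceptrons are applied to the
feature vector at every pair of indices, and `W_{:,:,j} = m₁(X)_{:,:,j} · m₂(X)_{:,:,j}` is a
product of `n × n` matrices for every channel `j`. -/
def Block.eval (σ : ℝ → ℝ) {n a b b' : ℕ} (B : Block a b b') (X : Tensor n a) :
    Tensor n (b' + b) :=
  fun i₁ i₂ => Fin.append
    (B.m₃.eval σ (X i₁ i₂))
    (fun j : Fin b =>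
      ((Matrix.of fun p q => B.m₁.eval σ (X p q) j) *
        (Matrix.of fun p q => B.m₂.eval σ (X p q) j) : Matrix (Fin n) (Fin n) ℝ) i₁ i₂)

/-- Sequences `B₁, …, B_d`, `d ≥ 1`, of composable blocks with `a` input channels and `c` output
channels. -/
inductive Blocks : ℕ → ℕ → Type
  /-- a single block -/
  | single {a b b' : ℕ} (B : Block a b b') : Blocks a (b' + b)
  /-- a block that is applied first, followed by the remaining blocks -/
  | cons {a b b' c : ℕ} (B : Block a b b') (rest : Blocks (b' + b) c) : Blocks a c

/-- The composition `B_d ∘ ⋯ ∘ B₁`. -/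
def Blocks.eval (σ : ℝ → ℝ) {n : ℕ} : {a c : ℕ} → Blocks a c → Tensor n a → Tensor n c
  | _, _, .single B, X => B.eval σ X
  | _, _, .cons B rest, X => rest.eval σ (B.eval σ X)

/-- A network `F = m ∘ h ∘ B_d ∘ ⋯ ∘ B₁` on `ℝ^{n × n × a}` with values in `ℝ^b`. -/
structure Network (n a b : ℕ) where
  /-- the number of channels after the last block -/
  c : ℕ
  /-- the number of outputs of the invariant layer -/
  c' : ℕ
  /-- the blocks -/
  blocks : Blocks a c
  /-- the invariant linear layer -/
  h : Tensor n c →ₗ[ℝ] (Fin c' → ℝ)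
  /-- invariance of the layer `h` -/
  h_invariant : ∀ (g : Equiv.Perm (Fin n)) (X : Tensor n c), h (permute g X) = h X
  /-- the final multilayer perceptron -/
  m : MLP c' b

/-- The function computed by a network with activation function `σ`. -/
def Network.eval (σ : ℝ → ℝ) {n a b : ℕ} (F : Network n a b) (X : Tensor n a) : Fin b → ℝ :=
  F.m.eval σ (F.h (F.blocks.eval σ X))

end WLNet

namespace WLNet

/-! ### Continuous functions that are not affine -/

/-! Distinguishing power. One entry of a matrix product is a sum over `w` of products of features at
`(u, w)` and `(w, v)`. If the two MLPs output indicators of feature values, that sum counts the `w`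
with a prescribed pair of values, which is one round of folklore 2-WL (`exists_refining_block`). On
two fixed tensors only finitely many equality relations between features occur, so some sequence of
blocks cannot be refined further (`exists_stable_blocks`). If no network separates the inputs,
summing indicators over all index pairs shows that the stable features have equal histograms
(`exists_equiv_of_forall_eval_eq`). The relation "equal stable feature" then matches triples of `G`
with triples of `G'` so that 3-WL never tells them apart (`StableRel.not_wlDistinguishes`).

The indicators need exact interpolation at finitely many points (`MLP.exists_eval_eq`). A continuous
non-affine `σ` yields squares of affine functions in the span of its dilated translates, and spaces
of functions closed under squaring that contain 1 and separate points are everything.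

Invariance holds because blocks commute with permutations and `h` is invariant; isomorphic graphs
have inputs in the same orbit. -/

theorem exists_affine_of_second_difference_eq_zero {σ : ℝ → ℝ} (hσ : Continuous σ)
    (h : ∀ x t, σ (x + 2 * t) - 2 * σ (x + t) + σ x = 0) :
    ∃ s t : ℝ, ∀ x, σ x = s * x + t := by
  have hmid : ∀ x y, σ (x + y) - σ 0 = (σ x - σ 0) + (σ y - σ 0) := by
    intro x y
    -- The point `x + y` is the midpoint of `2 * x` and `2 * y`, while `x` and `y` are the midpoints
    -- of 0 with these; together they make `σ - σ 0` additive.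
    have h1 := h (2 * x) (y - x)
    have h2 := h 0 x
    have h3 := h 0 y
    rw [show 2 * x + 2 * (y - x) = 2 * y by ring, show 2 * x + (y - x) = x + y by ring] at h1
    simp only [zero_add] at h2 h3
    linarith
  let τ : ℝ →+ ℝ :=
    { toFun := fun x => σ x - σ 0
      map_zero' := by simp
      map_add' := hmid }
  have hτ : Continuous τ := hσ.sub continuous_const
  refine ⟨τ 1, σ 0, fun x => ?_⟩
  have := map_real_smul τ hτ x 1
  simp only [smul_eq_mul, mul_one] at this
  have h' : τ x = σ x - σ 0 := rfl
  linarith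

/-- A linear relation that holds between all dilated translates of a continuous function that is
not affine also holds between the squares. -/
theorem sum_mul_sq_eq_zero {σ : ℝ → ℝ} (hσ : Continuous σ)
    (hσ' : ¬ ∃ s t : ℝ, ∀ x, σ x = s * x + t) {ι : Type*} [Fintype ι] (l f : ι → ℝ)
    (h : ∀ w b : ℝ, ∑ i, l i * σ (w * f i + b) = 0) : ∑ i, l i * f i ^ 2 = 0 := by
  obtain ⟨x, t, hxt⟩ : ∃ x t, σ (x + 2 * t) - 2 * σ (x + t) + σ x ≠ 0 := by
    by_contra! hcon
    exact hσ' (exists_affine_of_second_difference_eq_zero hσ hcon)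
  -- Since `σ` need not be differentiable, integrate twice. The relation for `S₂` then holds up to a
  -- term affine in `b`, which a second difference in `b` removes. Two derivatives in `w` at `w = 0`
  -- bring out `f i ^ 2` times the nonzero second difference of `σ`.
  obtain ⟨S₁, hS₁⟩ : ∃ S₁ : ℝ → ℝ, ∀ x, HasDerivAt S₁ (σ x) x :=
    ⟨fun x => ∫ y in (0 : ℝ)..x, σ y, fun x => hσ.integral_hasStrictDerivAt 0 x |>.hasDerivAt⟩
  have hS₁c : Continuous S₁ := continuous_iff_continuousAt.2 fun x => (hS₁ x).continuousAt
  obtain ⟨S₂, hS₂⟩ : ∃ S₂ : ℝ → ℝ, ∀ x, HasDerivAt S₂ (S₁ x) x :=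
    ⟨fun x => ∫ y in (0 : ℝ)..x, S₁ y, fun x => hS₁c.integral_hasStrictDerivAt 0 x |>.hasDerivAt⟩
  have hD₁ : ∀ w b c, ∑ i, l i * S₁ (w * f i + b) = ∑ i, l i * S₁ (w * f i + c) := by
    intro w
    have hd : ∀ b, HasDerivAt (fun b => ∑ i, l i * S₁ (w * f i + b)) 0 b := by
      intro b
      rw [← h w b]
      exact HasDerivAt.fun_sum fun i _ => ((hS₁ _).comp_const_add _ _).const_mul _
    exact is_const_of_deriv_eq_zero (fun b => (hd b).differentiableAt) fun b => (hd b).deriv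
  have hD₂ : ∀ w b, ∑ i, l i * S₂ (w * f i + b) =
      b * ∑ i, l i * S₁ (w * f i) + ∑ i, l i * S₂ (w * f i) := by
    intro w b
    have hd : ∀ b, HasDerivAt (fun b => ∑ i, l i * S₂ (w * f i + b) -
        b * ∑ i, l i * S₁ (w * f i)) 0 b := by
      intro b
      have h1 : HasDerivAt (fun b => ∑ i, l i * S₂ (w * f i + b))
          (∑ i, l i * S₁ (w * f i + b)) b :=
        HasDerivAt.fun_sum fun i _ => ((hS₂ _).comp_const_add _ _).const_mul _
      have h2 := h1.sub ((hasDerivAt_id b).mul_const (∑ i, l i * S₁ (w * f i)))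
      have h3 : ∑ i, l i * S₁ (w * f i + b) - 1 * ∑ i, l i * S₁ (w * f i) = 0 := by
        rw [hD₁ w b 0]
        simp
      exact h3 ▸ h2
    have := is_const_of_deriv_eq_zero (fun b => (hd b).differentiableAt)
      (fun b => (hd b).deriv) b 0
    simp only [add_zero, zero_mul, sub_zero] at this
    linarith
  have hE : ∀ w, ∑ i, l i * (S₂ (w * f i + (x + 2 * t)) - 2 * S₂ (w * f i + (x + t)) +
      S₂ (w * f i + x)) = 0 := by
    intro w
    have h1 := hD₂ w (x + 2 * t)
    have h2 := hD₂ w (x + t)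
    have h3 := hD₂ w x
    calc _ = ∑ i, l i * S₂ (w * f i + (x + 2 * t)) - 2 * ∑ i, l i * S₂ (w * f i + (x + t)) +
          ∑ i, l i * S₂ (w * f i + x) := by
          rw [Finset.mul_sum, ← Finset.sum_sub_distrib, ← Finset.sum_add_distrib]
          exact Finset.sum_congr rfl fun i _ => by ring
      _ = 0 := by rw [h1, h2, h3]; ring
  have hlin : ∀ (c b w : ℝ), HasDerivAt (fun w => w * c + b) c w := fun c b w => by
    simpa using ((hasDerivAt_id w).mul_const c).add_const b
  have key : ∀ {U U' : ℝ → ℝ}, (∀ x, HasDerivAt U (U' x) x) → ∀ m : ι → ℝ,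
      (∀ w, ∑ i, m i * (U (w * f i + (x + 2 * t)) - 2 * U (w * f i + (x + t)) +
        U (w * f i + x)) = 0) →
      ∀ w, ∑ i, (m i * f i) * (U' (w * f i + (x + 2 * t)) - 2 * U' (w * f i + (x + t)) +
        U' (w * f i + x)) = 0 := by
    intro U U' hU m hm w
    have hd : HasDerivAt (fun w => ∑ i, m i * (U (w * f i + (x + 2 * t)) -
        2 * U (w * f i + (x + t)) + U (w * f i + x)))
        (∑ i, m i * (U' (w * f i + (x + 2 * t)) * f i - 2 * (U' (w * f i + (x + t)) * f i) +
        U' (w * f i + x) * f i)) w :=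
      HasDerivAt.fun_sum fun i _ => ((((hU _).comp w (hlin _ _ w)).sub
        (((hU _).comp w (hlin _ _ w)).const_mul 2)).add ((hU _).comp w (hlin _ _ w))).const_mul _
    have h0 : HasDerivAt (fun w => ∑ i, m i * (U (w * f i + (x + 2 * t)) -
        2 * U (w * f i + (x + t)) + U (w * f i + x))) 0 w := by
      simp only [hm]
      exact hasDerivAt_const w 0
    rw [← hd.unique h0]
    exact Finset.sum_congr rfl fun i _ => by ring
  have := key hS₁ _ (key hS₂ l hE) 0
  simp only [zero_mul, zero_add, ← Finset.sum_mul] at this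
  rcases mul_eq_zero.1 this with h | h
  · rw [← h]
    exact Finset.sum_congr rfl fun i _ => by ring
  · exact absurd h hxt

/-- By duality: a functional that vanishes on the span but not at `f ^ 2` would be a linear relation
contradicting `sum_mul_sq_eq_zero`. -/
theorem sq_mem_span {σ : ℝ → ℝ} (hσ : Continuous σ)
    (hσ' : ¬ ∃ s t : ℝ, ∀ x, σ x = s * x + t) {ι : Type*} [Fintype ι] {L : Submodule ℝ (ι → ℝ)}
    (h1 : (1 : ι → ℝ) ∈ L) {f : ι → ℝ} (hf : f ∈ L) :
    f ^ 2 ∈ Submodule.span ℝ ((fun g : ι → ℝ => σ ∘ g) '' L) := by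
  classical
  by_contra hcon
  obtain ⟨φ, hφ, hle⟩ := Submodule.exists_le_ker_of_notMem hcon
  have hφs : ∀ g : ι → ℝ, φ g = ∑ i, φ (Pi.single i 1) * g i := by
    intro g
    rw [LinearMap.pi_apply_eq_sum_univ φ g]
    refine Finset.sum_congr rfl fun i _ => ?_
    rw [smul_eq_mul, mul_comm]
    congr 2
    ext j
    simp [Pi.single_apply, eq_comm]
  apply hφ
  rw [hφs]
  refine sum_mul_sq_eq_zero hσ hσ' _ f fun w b => ?_
  have hm : w • f + b • (1 : ι → ℝ) ∈ L := L.add_mem (L.smul_mem _ hf) (L.smul_mem _ h1)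
  have := hle (Submodule.subset_span ⟨_, hm, rfl⟩)
  rw [LinearMap.mem_ker, hφs] at this
  simpa using this

/-- A space of functions on a finite set that contains the constants, separates points and is
closed under squaring is the space of all functions. -/
theorem eq_top_of_sq_mem {ι : Type*} [Finite ι] {L : Submodule ℝ (ι → ℝ)}
    (h1 : (1 : ι → ℝ) ∈ L) (hsep : ∀ i j, i ≠ j → ∃ f ∈ L, f i ≠ f j)
    (hsq : ∀ f ∈ L, f ^ 2 ∈ L) : L = ⊤ := by
  classical
  have := Fintype.ofFinite ι
  have hmul : ∀ f g, f ∈ L → g ∈ L → f * g ∈ L := by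
    intro f g hf hg
    have : f * g = (1 / 2 : ℝ) • ((f + g) ^ 2 - f ^ 2 - g ^ 2) := by
      ext i
      simp
      ring
    rw [this]
    exact L.smul_mem _ (L.sub_mem (L.sub_mem (hsq _ (L.add_mem hf hg)) (hsq _ hf)) (hsq _ hg))
  let A : Subalgebra ℝ (ι → ℝ) := L.toSubalgebra h1 hmul
  have hsingle : ∀ i, Pi.single i (1 : ℝ) ∈ L := by
    intro i
    have hex : ∀ j, ∃ f ∈ A, f i = 1 ∧ (j ≠ i → f j = 0) := by
      intro j
      by_cases hij : j = i
      · exact ⟨1, A.one_mem, rfl, fun h => absurd hij h⟩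
      · obtain ⟨f, hf, hne⟩ := hsep i j (Ne.symm hij)
        refine ⟨(f i - f j)⁻¹ • (f - f j • 1), ?_, ?_, fun _ => ?_⟩
        · exact A.smul_mem (A.sub_mem hf (A.smul_mem A.one_mem _)) _
        · have := sub_ne_zero.2 hne
          simp [this]
        · simp
    choose f hfA hfi hfj using hex
    have hprod : (Pi.single i (1 : ℝ) : ι → ℝ) = ∏ j, f j := by
      ext j
      rw [Finset.prod_apply]
      by_cases hij : j = i
      · subst hij
        simp [hfi]
      · rw [Pi.single_eq_of_ne hij]
        exact (Finset.prod_eq_zero (f := fun k => f k j) (Finset.mem_univ j) (hfj j hij)).symm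
    rw [hprod]
    exact A.prod_mem fun j _ => hfA j
  rw [eq_top_iff]
  intro g _
  rw [show g = ∑ i, g i • (Pi.single i (1 : ℝ) : ι → ℝ) by
    ext j; simp [Finset.sum_apply, Pi.single_apply]]
  exact L.sum_mem fun i _ => L.smul_mem _ (hsingle i)

/-! ### Interpolation by multilayer perceptrons -/

/-- The affine functions of the feature vectors `x i`, as functions of `i`. -/
def affineFunctions {ι : Type*} {a : ℕ} (x : ι → Fin a → ℝ) : Submodule ℝ (ι → ℝ) :=
  Submodule.span ℝ (insert 1 (Set.range fun j i => x i j))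

theorem one_mem_affineFunctions {ι : Type*} {a : ℕ} (x : ι → Fin a → ℝ) :
    (1 : ι → ℝ) ∈ affineFunctions x :=
  Submodule.subset_span (Set.mem_insert _ _)

theorem coord_mem_affineFunctions {ι : Type*} {a : ℕ} (x : ι → Fin a → ℝ) (j : Fin a) :
    (fun i => x i j) ∈ affineFunctions x :=
  Submodule.subset_span (Set.mem_insert_of_mem _ ⟨j, rfl⟩)

theorem exists_of_mem_affineFunctions {ι : Type*} {a : ℕ} {x : ι → Fin a → ℝ} {f : ι → ℝ}
    (hf : f ∈ affineFunctions x) : ∃ (w : Fin a → ℝ) (c : ℝ), ∀ i, f i = w ⬝ᵥ x i + c := by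
  obtain ⟨c, g, hg, rfl⟩ := Submodule.mem_span_insert.1 hf
  obtain ⟨w, rfl⟩ := (Submodule.mem_span_range_iff_exists_fun ℝ).1 hg
  refine ⟨w, c, fun i => ?_⟩
  simp [dotProduct, add_comm]

theorem exists_matrix_of_mem_affineFunctions {ι : Type*} {a b : ℕ} {x : ι → Fin a → ℝ}
    {y : Fin b → ι → ℝ} (hy : ∀ j, y j ∈ affineFunctions x) :
    ∃ (W : Matrix (Fin b) (Fin a) ℝ) (c : Fin b → ℝ), ∀ i j, (W.mulVec (x i) + c) j = y j i := by
  choose W c h using fun j => exists_of_mem_affineFunctions (hy j)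
  exact ⟨W, c, fun i j => (h j i).symm⟩

/-- Interpolation by multilayer perceptrons at finitely many points. -/
theorem MLP.exists_eval_eq_of_injective {σ : ℝ → ℝ} (hσ : Continuous σ)
    (hσ' : ¬ ∃ s t : ℝ, ∀ x, σ x = s * x + t) {ι : Type*} [Finite ι] {b : ℕ}
    (y : ι → Fin b → ℝ) {a : ℕ} (x : ι → Fin a → ℝ) (hx : Function.Injective x) :
    ∃ M : MLP a b, ∀ i, M.eval σ (x i) = y i := by
  have := Fintype.ofFinite ι
  obtain ⟨L, hL⟩ : ∃ L, L = affineFunctions x := ⟨_, rfl⟩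
  induction L using WellFoundedGT.induction generalizing a with
  | _ L ih =>
    subst hL
    by_cases htop : affineFunctions x = ⊤
    · obtain ⟨W, c, h⟩ := exists_matrix_of_mem_affineFunctions (x := x) (y := fun j i => y i j)
        fun j => by rw [htop]; trivial
      exact ⟨.output W c, fun i => funext fun j => h i j⟩
    -- The neurons of the hidden layer are chosen to span everything that `σ` makes of affine
    -- functions of the current features. The induction is on the space of affine functions, which
    -- each such layer strictly enlarges.
    · obtain ⟨f, hf, hspan, -⟩ := Submodule.exists_fun_fin_finrank_span_eq ℝ
        ((fun g : ι → ℝ => σ ∘ g) '' (affineFunctions x : Set (ι → ℝ)))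
      choose g hg hgf using hf
      obtain ⟨W, c, h⟩ := exists_matrix_of_mem_affineFunctions hg
      let x' : ι → Fin _ → ℝ := fun i k => σ ((W.mulVec (x i) + c) k)
      have hx'f : ∀ k, (fun i => x' i k) = f k := fun k => by
        rw [← hgf k]
        exact funext fun i => congrArg σ (h i k)
      have hsq : ∀ u ∈ affineFunctions x, u ^ 2 ∈ affineFunctions x' := by
        intro u hu
        have := sq_mem_span hσ hσ' (one_mem_affineFunctions x) hu
        rw [← hspan] at this
        refine Submodule.span_le.2 ?_ this
        rintro _ ⟨k, rfl⟩
        rw [← hx'f k]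
        exact coord_mem_affineFunctions x' k
      have hle : affineFunctions x ≤ affineFunctions x' := by
        intro u hu
        have hu1 := hsq _ (Submodule.add_mem _ hu (one_mem_affineFunctions x))
        have : u = (1 / 2 : ℝ) • ((u + 1) ^ 2 - u ^ 2 - 1) := by
          ext i
          simp
          ring
        rw [this]
        exact Submodule.smul_mem _ _ (Submodule.sub_mem _ (Submodule.sub_mem _ hu1 (hsq _ hu))
          (one_mem_affineFunctions x'))
      -- If the space did not grow, it would be closed under squaring and hence already be
      -- everything.
      have hne : affineFunctions x ≠ affineFunctions x' := by
        intro heq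
        refine htop (eq_top_of_sq_mem (one_mem_affineFunctions x) (fun i j hij => ?_)
          fun u hu => heq ▸ hsq u hu)
        obtain ⟨k, hk⟩ := Function.ne_iff.1 (hx.ne hij)
        exact ⟨_, coord_mem_affineFunctions x k, hk⟩
      have hx' : Function.Injective x' := by
        intro i j hij
        refine hx (funext fun k => ?_)
        obtain ⟨w, d, hwd⟩ := exists_of_mem_affineFunctions (hle (coord_mem_affineFunctions x k))
        exact (hwd i).trans ((by rw [hij] : w ⬝ᵥ x' i + d = w ⬝ᵥ x' j + d).trans (hwd j).symm)
      obtain ⟨M, hM⟩ := ih _ (lt_of_le_of_ne hle hne) x' hx' rfl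
      exact ⟨.hidden W c M, hM⟩

theorem MLP.exists_eval_eq {σ : ℝ → ℝ} (hσ : Continuous σ)
    (hσ' : ¬ ∃ s t : ℝ, ∀ x, σ x = s * x + t) {a b : ℕ} (A : Finset (Fin a → ℝ))
    (y : (Fin a → ℝ) → Fin b → ℝ) : ∃ M : MLP a b, ∀ x ∈ A, M.eval σ x = y x := by
  obtain ⟨M, hM⟩ := MLP.exists_eval_eq_of_injective hσ hσ' (fun x : A => y x) (fun x : A => x.1)
    Subtype.val_injective
  exact ⟨M, fun x hx => hM ⟨x, hx⟩⟩

/-! ### Matching finite families -/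

theorem map_univ_eq_of_equiv {α β γ : Type*} [Fintype α] [Fintype β] {f : α → γ} {g : β → γ}
    (e : α ≃ β) (h : ∀ x, f x = g (e x)) :
    (Finset.univ : Finset α).val.map f = (Finset.univ : Finset β).val.map g := by
  rw [← Multiset.map_univ_val_equiv e, Multiset.map_map]
  exact Multiset.map_congr rfl fun x _ => h x

theorem exists_equiv_of_card_fiber_eq {α β γ : Type*} [Fintype α] [Fintype β] [DecidableEq γ]
    {f : α → γ} {g : β → γ}
    (h : ∀ c, (Finset.univ.filter fun x => f x = c).card =
      (Finset.univ.filter fun y => g y = c).card) :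
    ∃ e : α ≃ β, ∀ x, f x = g (e x) := by
  have hc : ∀ c, Nonempty ({x // f x = c} ≃ {y // g y = c}) := fun c =>
    Fintype.card_eq.1 (by rw [Fintype.card_subtype, Fintype.card_subtype, h c])
  exact ⟨Equiv.ofFiberEquiv fun c => (hc c).some, fun x => (Equiv.ofFiberEquiv_map _ x).symm⟩

/-! ### Stable relations between pairs bound the 3-WL test -/

/-- A stable matching of the pairs of vertices of `G` with those of `G'`, as produced by the folklore
2-WL test. -/
structure StableRel {V V' : Type*} {S : Type} (G : ColoredGraph V S) (G' : ColoredGraph V' S)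
    (R : V → V → V' → V' → Prop) : Prop where
  symm : ∀ {u v u' v'}, R u v u' v' → R v u v' u'
  stable : ∀ {u v u' v'}, R u v u' v' → ∃ π : V ≃ V', ∀ w, R u w u' (π w) ∧ R w v (π w) v'
  eq_iff : ∀ {u v u' v'}, R u v u' v' → (u = v ↔ u' = v')
  adj_iff : ∀ {u v u' v'}, R u v u' v' → (G.graph.Adj u v ↔ G'.graph.Adj u' v')
  color_eq : ∀ {u u'}, R u u u' u' → G.color u = G'.color u'

namespace StableRel

variable {V V' : Type*} {S : Type} {G : ColoredGraph V S} {G' : ColoredGraph V' S}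
  {R : V → V → V' → V' → Prop}

theorem diag (hR : StableRel G G' R) {u v u' v'} (h : R u v u' v') : R u u u' u' := by
  obtain ⟨π, hπ⟩ := hR.stable h
  -- Since `R u u u' (π u)`, the equality pattern forces `π u = u'`.
  have := (hπ u).1
  rwa [← (hR.eq_iff this).1 rfl] at this

/-- Replacing entry `j` by `w` changes only the pairs that involve `j`. The bijection from stability
for the two remaining entries matches all of these at once, so it matches the `j`-th neighbourhoods.
-/
theorem wlColoring_eq [Fintype V] [Fintype V'] (hR : StableRel G G' R) (l : ℕ) :
    ∀ (i : Fin 3 → V) (i' : Fin 3 → V'), (∀ q r, R (i q) (i r) (i' q) (i' r)) →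
      wlColoring 3 G l i = wlColoring 3 G' l i' := by
  induction l with
  | zero =>
    intro i i' h
    have h1 : (fun q r => i q = i r) = fun q r => i' q = i' r :=
      funext fun q => funext fun r => propext (hR.eq_iff (h q r))
    have h2 : (fun q => G.color (i q)) = fun q => G'.color (i' q) :=
      funext fun q => hR.color_eq (h q q)
    have h3 : (fun q r => G.graph.Adj (i q) (i r)) = fun q r => G'.graph.Adj (i' q) (i' r) :=
      funext fun q => funext fun r => propext (hR.adj_iff (h q r))
    simp only [wlColoring, h1, h2, h3]
    rfl
  | succ l ih =>
    intro i i' h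
    refine Prod.ext (ih i i' h) (funext fun j => ?_)
    obtain ⟨q, r, hqj, hrj, hall⟩ : ∃ q r : Fin 3, q ≠ j ∧ r ≠ j ∧ ∀ b, b ≠ j → b = q ∨ b = r := by
      revert j
      decide
    obtain ⟨π, hπ⟩ := hR.stable (h q r)
    refine map_univ_eq_of_equiv π fun w => ih _ _ fun a b => ?_
    have hside : ∀ b, b ≠ j → R (i b) w (i' b) (π w) := by
      intro b hb
      rcases hall b hb with rfl | rfl
      · exact (hπ w).1
      · exact hR.symm (hπ w).2
    by_cases ha : a = j <;> by_cases hb : b = j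
    · subst ha hb
      simpa using hR.diag (hπ w).2
    · subst ha
      simpa [hb] using hR.symm (hside b hb)
    · subst hb
      simpa [ha] using hside a ha
    · simpa [ha, hb] using h a b

/-- Triples as pairs followed by a third entry. -/
def tripleEquiv (V : Type*) : (Fin 3 → V) ≃ (V × V) × V where
  toFun i := ((i 0, i 1), i 2)
  invFun p := ![p.1.1, p.1.2, p.2]
  left_inv i := by
    ext k
    fin_cases k <;> rfl
  right_inv _ := rfl

/-- Triples are matched by a shear: the first two entries by `π`, the third by the bijection that
stability attaches to that pair. -/
theorem not_wlDistinguishes [Fintype V] [Fintype V'] (hR : StableRel G G' R)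
    (π : V × V ≃ V' × V') (hπ : ∀ p, R p.1 p.2 (π p).1 (π p).2) : ¬ WLDistinguishes 3 G G' := by
  rintro ⟨l, hl⟩
  apply hl
  choose ρ hρ using fun p : V × V => hR.stable (hπ p)
  refine map_univ_eq_of_equiv
    ((tripleEquiv V).trans ((Equiv.prodShear π ρ).trans (tripleEquiv V').symm)) fun i => ?_
  refine hR.wlColoring_eq l _ _ ?_
  have h01 := hπ (i 0, i 1)
  have h02 := (hρ (i 0, i 1) (i 2)).1
  have h21 := (hρ (i 0, i 1) (i 2)).2
  have h10 := hR.symm h01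
  have h20 := hR.symm h02
  have h12 := hR.symm h21
  have h00 := hR.diag h01
  have h11 := hR.diag h10
  have h22 := hR.diag h20
  intro q r
  fin_cases q <;> fin_cases r <;> assumption

end StableRel

/-! ### Invariance -/

theorem Block.eval_permute (σ : ℝ → ℝ) {n a b b' : ℕ} (B : Block a b b')
    (g : Equiv.Perm (Fin n)) (X : Tensor n a) :
    B.eval σ (permute g X) = permute g (B.eval σ X) := by
  funext i₁ i₂
  simp only [Block.eval, permute]
  congr 1
  funext j
  simp only [Matrix.mul_apply, Matrix.of_apply]
  exact Equiv.sum_comp g⁻¹ fun k =>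
    B.m₁.eval σ (X (g⁻¹ i₁) k) j * B.m₂.eval σ (X k (g⁻¹ i₂)) j

theorem Blocks.eval_permute (σ : ℝ → ℝ) {n a c : ℕ} (Bs : Blocks a c)
    (g : Equiv.Perm (Fin n)) (X : Tensor n a) :
    Bs.eval σ (permute g X) = permute g (Bs.eval σ X) := by
  induction Bs with
  | single B => exact B.eval_permute σ g X
  | cons B rest ih => simp only [Blocks.eval, Block.eval_permute, ih]

theorem Network.eval_permute (σ : ℝ → ℝ) {n a b : ℕ} (F : Network n a b)
    (g : Equiv.Perm (Fin n)) (X : Tensor n a) : F.eval σ (permute g X) = F.eval σ X := by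
  simp only [Network.eval, Blocks.eval_permute, F.h_invariant]

theorem append_eq_append_iff {m n : ℕ} {α : Type*} {a a' : Fin m → α} {b b' : Fin n → α} :
    Fin.append a b = Fin.append a' b' ↔ a = a' ∧ b = b' := by
  refine ⟨fun h => ⟨funext fun i => ?_, funext fun i => ?_⟩, fun ⟨h, h'⟩ => by rw [h, h']⟩
  · simpa using congrFun h (Fin.castAdd n i)
  · simpa using congrFun h (Fin.natAdd m i)

/-- Off the diagonal the colour channels vanish on both sides, so colours are compared on the
diagonal only. -/
theorem inputTensor_eq_iff {V V' : Type*} {n e : ℕ} {G : ColoredGraph V (Fin e → ℝ)}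
    {G' : ColoredGraph V' (Fin e → ℝ)} {ν : Fin n ≃ V} {ν' : Fin n ≃ V'} {u v u' v' : Fin n} :
    inputTensor G ν u v = inputTensor G' ν' u' v' ↔
      (u = v ↔ u' = v') ∧ (G.graph.Adj (ν u) (ν v) ↔ G'.graph.Adj (ν' u') (ν' v')) ∧
        (u = v → G.color (ν u) = G'.color (ν' u')) := by
  classical
  have hind : ∀ p q : Prop, ∀ [Decidable p] [Decidable q],
      ((if p then (1 : ℝ) else 0) = if q then 1 else 0) ↔ (p ↔ q) := by
    intro p q _ _
    by_cases hp : p <;> by_cases hq : q <;> simp [hp, hq]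
  simp only [inputTensor, append_eq_append_iff, Matrix.vecCons_inj, hind, and_true]
  constructor
  · rintro ⟨h1, h2, h3⟩
    refine ⟨h3, h2, fun h => funext fun k => ?_⟩
    simpa [h, h3.1 h] using congrFun h1 k
  · rintro ⟨h3, h2, h1⟩
    refine ⟨funext fun k => ?_, h2, h3⟩
    by_cases h : u = v
    · rw [if_pos h, if_pos (h3.1 h), h1 h]
    · rw [if_neg h, if_neg (mt h3.2 h)]

theorem inputTensor_eq_permute {V V' : Type*} {n e : ℕ} {G : ColoredGraph V (Fin e → ℝ)}
    {G' : ColoredGraph V' (Fin e → ℝ)} (φ : G.graph ≃g G'.graph)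
    (hφ : ∀ v, G'.color (φ v) = G.color v) (ν : Fin n ≃ V) (ν' : Fin n ≃ V') :
    inputTensor G ν =
      permute ((ν.trans (φ.toEquiv.trans ν'.symm)).symm : Equiv.Perm (Fin n))
        (inputTensor G' ν') := by
  have key : ∀ i, ν' ((ν.trans (φ.toEquiv.trans ν'.symm)).symm⁻¹ i) = φ (ν i) := by
    intro i
    change ν' (ν'.symm (φ (ν i))) = _
    simp
  funext i₁ i₂
  refine inputTensor_eq_iff.2 ⟨(EmbeddingLike.apply_eq_iff_eq _).symm, ?_, fun _ => ?_⟩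
  · rw [key, key, φ.map_adj_iff]
  · rw [key, hφ]

theorem Network.eval_inputTensor_eq (σ : ℝ → ℝ) {V V' : Type*} {n e b : ℕ}
    {G : ColoredGraph V (Fin e → ℝ)} {G' : ColoredGraph V' (Fin e → ℝ)} (h : G.Isomorphic G')
    (F : Network n (e + 2) b) (ν : Fin n ≃ V) (ν' : Fin n ≃ V') :
    F.eval σ (inputTensor G ν) = F.eval σ (inputTensor G' ν') := by
  obtain ⟨φ, hφ⟩ := h
  rw [inputTensor_eq_permute φ hφ ν ν', F.eval_permute]

theorem ColoredGraph.Isomorphic.refl {V : Type*} {S : Type} (G : ColoredGraph V S) :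
    G.Isomorphic G :=
  ⟨SimpleGraph.Iso.refl, fun _ => rfl⟩

/-! ### Blocks that refine the features -/

/-- The identity as a multilayer perceptron without hidden layers. -/
def MLP.id (a : ℕ) : MLP a a := .output 1 0

@[simp]
theorem MLP.eval_id (σ : ℝ → ℝ) {a : ℕ} (x : Fin a → ℝ) : (MLP.id a).eval σ x = x := by
  simp [MLP.id, MLP.eval]

/-- A sequence of blocks followed by a further block. -/
def Blocks.snoc : {a c : ℕ} → Blocks a c → {b b' : ℕ} → Block c b b' → Blocks a (b' + b)
  | _, _, .single B, _, _, B' => .cons B (.single B')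
  | _, _, .cons B rest, _, _, B' => .cons B (rest.snoc B')

theorem Blocks.eval_snoc (σ : ℝ → ℝ) {n a c b b' : ℕ} (Bs : Blocks a c) (B : Block c b b')
    (X : Tensor n a) : (Bs.snoc B).eval σ X = B.eval σ (Bs.eval σ X) := by
  induction Bs with
  | single B => rfl
  | cons B rest ih => exact ih _ _

/-- A block that performs one round of the folklore 2-WL refinement on given tensors. -/
theorem exists_refining_block {σ : ℝ → ℝ} (hσ : Continuous σ)
    (hσ' : ¬ ∃ s t : ℝ, ∀ x, σ x = s * x + t) {n c : ℕ} (X X' : Tensor n c) :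
    ∃ (b : ℕ) (B : Block c b c), ∀ u v u' v', B.eval σ X u v = B.eval σ X' u' v' ↔
      X u v = X' u' v' ∧
        ∃ π : Equiv.Perm (Fin n), ∀ w, X u w = X' u' (π w) ∧ X w v = X' (π w) v' := by
  classical
  let A : Finset (Fin c → ℝ) := (Finset.univ.image fun p : Fin n × Fin n => X p.1 p.2) ∪
    Finset.univ.image fun p : Fin n × Fin n => X' p.1 p.2
  have hA : ∀ u v, X u v ∈ A := fun u v =>
    Finset.mem_union_left _ (Finset.mem_image.2 ⟨(u, v), Finset.mem_univ _, rfl⟩)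
  have hA' : ∀ u v, X' u v ∈ A := fun u v =>
    Finset.mem_union_right _ (Finset.mem_image.2 ⟨(u, v), Finset.mem_univ _, rfl⟩)
  let ε := Fintype.equivFin (A × A)
  -- There is one product channel for each pair of values in `A`: the two factors are the indicators
  -- of its components.
  obtain ⟨M₁, hM₁⟩ := MLP.exists_eval_eq hσ hσ' A
    fun x j => if x = (ε.symm j).1 then (1 : ℝ) else 0
  obtain ⟨M₂, hM₂⟩ := MLP.exists_eval_eq hσ hσ' A
    fun x j => if x = (ε.symm j).2 then (1 : ℝ) else 0
  have hcount : ∀ Y : Tensor n c, (∀ u v, Y u v ∈ A) → ∀ u v,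
      (Block.mk M₁ M₂ (MLP.id c)).eval σ Y u v = Fin.append (Y u v) fun j =>
        ((Finset.univ.filter fun w =>
          (Y u w, Y w v) = (((ε.symm j).1 : Fin c → ℝ), ((ε.symm j).2 : Fin c → ℝ))).card : ℝ) := by
    intro Y hY u v
    simp only [Block.eval, MLP.eval_id]
    congr 1
    funext j
    rw [Matrix.mul_apply, Finset.card_filter]
    push_cast
    refine Finset.sum_congr rfl fun w _ => ?_
    simp only [Matrix.of_apply, hM₁ _ (hY u w), hM₂ _ (hY w v), Prod.mk.injEq, ite_and]
    split_ifs <;> simp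
  refine ⟨_, ⟨M₁, M₂, MLP.id c⟩, fun u v u' v' => ?_⟩
  rw [hcount X hA, hcount X' hA', append_eq_append_iff]
  refine and_congr_right fun _ => ⟨fun h => ?_, ?_⟩
  · obtain ⟨π, hπ⟩ := exists_equiv_of_card_fiber_eq
      (f := fun w => (X u w, X w v)) (g := fun w => (X' u' w, X' w v')) (fun p => by
        by_cases hp : p.1 ∈ A ∧ p.2 ∈ A
        · have := congrFun h (ε (⟨p.1, hp.1⟩, ⟨p.2, hp.2⟩))
          simpa only [Equiv.symm_apply_apply, Prod.mk.eta, Nat.cast_inj] using this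
        -- A pair with a component outside `A` is never attained, so both fibres are empty.
        · rw [Finset.filter_false_of_mem, Finset.filter_false_of_mem]
          · rintro w - rfl
            exact hp ⟨hA' _ _, hA' _ _⟩
          · rintro w - rfl
            exact hp ⟨hA _ _, hA _ _⟩)
    exact ⟨π, fun w => Prod.mk.inj (hπ w)⟩
  · rintro ⟨π, hπ⟩
    funext j
    congr 1
    refine Finset.card_bij (fun w _ => π w) (fun w hw => ?_) (fun _ _ _ _ h => π.injective h)
      fun w hw => ⟨π.symm w, ?_, π.apply_symm_apply w⟩
    · rw [Finset.mem_filter] at hw ⊢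
      exact ⟨Finset.mem_univ _, by rw [← (hπ w).1, ← (hπ w).2]; exact hw.2⟩
    · rw [Finset.mem_filter] at hw ⊢
      refine ⟨Finset.mem_univ _, ?_⟩
      rw [(hπ _).1, (hπ _).2, π.apply_symm_apply]
      exact hw.2

/-- Some sequence of blocks computes features that further rounds of the folklore 2-WL refinement
do not refine. -/
theorem exists_stable_blocks {σ : ℝ → ℝ} (hσ : Continuous σ)
    (hσ' : ¬ ∃ s t : ℝ, ∀ x, σ x = s * x + t) {n a : ℕ} (X X' : Tensor n a)
    (hX : ∀ u v u' v', X u v = X' u' v' → X v u = X' v' u') :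
    ∃ (c : ℕ) (Bs : Blocks a c), ∀ u v u' v', Bs.eval σ X u v = Bs.eval σ X' u' v' →
      X u v = X' u' v' ∧ Bs.eval σ X v u = Bs.eval σ X' v' u' ∧
      ∃ π : Equiv.Perm (Fin n), ∀ w, Bs.eval σ X u w = Bs.eval σ X' u' (π w) ∧
        Bs.eval σ X w v = Bs.eval σ X' (π w) v' := by
  let rel (c : ℕ) (Bs : Blocks a c) : Set ((Fin n × Fin n) × (Fin n × Fin n)) :=
    {p | Bs.eval σ X p.1.1 p.1.2 = Bs.eval σ X' p.2.1 p.2.2}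
  -- A minimal relation in this finite set admits no further refinement. Membership also records
  -- that the features determine the input features and are compatible with transposition.
  let S : Set (Set ((Fin n × Fin n) × (Fin n × Fin n))) :=
    {r | ∃ (c : ℕ) (Bs : Blocks a c), r = rel c Bs ∧
      ∀ u v u' v', Bs.eval σ X u v = Bs.eval σ X' u' v' →
        X u v = X' u' v' ∧ Bs.eval σ X v u = Bs.eval σ X' v' u'}
  have hS : S.Nonempty := by
    -- A block without product channels passes the input through, as at least one block is required.
    let B : Block a 0 a := ⟨.output 0 0, .output 0 0, MLP.id a⟩
    have hB : ∀ u v u' v', B.eval σ X u v = B.eval σ X' u' v' ↔ X u v = X' u' v' := by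
      intro u v u' v'
      simp only [Block.eval, append_eq_append_iff, B, MLP.eval_id]
      exact and_iff_left (Subsingleton.elim _ _)
    refine ⟨_, _, .single B, rfl, fun u v u' v' h => ?_⟩
    have := (hB u v u' v').1 h
    exact ⟨this, (hB v u v' u').2 (hX _ _ _ _ this)⟩
  obtain ⟨r, ⟨c, Bs, rfl, hBs⟩, hmin⟩ := (Set.toFinite S).exists_minimal hS
  refine ⟨c, Bs, fun u v u' v' h => ?_⟩
  obtain ⟨b, B, hB⟩ := exists_refining_block hσ hσ' (Bs.eval σ X) (Bs.eval σ X')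
  simp only [← Blocks.eval_snoc] at hB
  have hmem : rel _ (Bs.snoc B) ∈ S := by
    refine ⟨_, _, rfl, fun u v u' v' h => ?_⟩
    obtain ⟨h1, π, hπ⟩ := (hB _ _ _ _).1 h
    -- Transposing `(u, v)` swaps the two legs through `w`, so the same `π` works.
    exact ⟨(hBs _ _ _ _ h1).1, (hB _ _ _ _).2 ⟨(hBs _ _ _ _ h1).2, π, fun w =>
      ⟨(hBs _ _ _ _ (hπ w).2).2, (hBs _ _ _ _ (hπ w).1).2⟩⟩⟩
  have hle : rel _ (Bs.snoc B) ≤ rel c Bs := fun p hp => ((hB _ _ _ _).1 hp).1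
  have h' : ((u, v), (u', v')) ∈ rel _ (Bs.snoc B) := hmin hmem hle h
  exact ⟨(hBs _ _ _ _ h).1, (hBs _ _ _ _ h).2, ((hB _ _ _ _).1 h').2⟩

/-! ### Networks that separate histograms of features -/

/-- The invariant layer that sums the features of all pairs of indices. -/
def sumPairs (n c : ℕ) : Tensor n c →ₗ[ℝ] (Fin c → ℝ) where
  toFun X := ∑ p : Fin n × Fin n, X p.1 p.2
  map_add' _ _ := Finset.sum_add_distrib
  map_smul' r X := (Finset.smul_sum (r := r) (f := fun p : Fin n × Fin n => X p.1 p.2)).symm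

theorem sumPairs_permute {n c : ℕ} (g : Equiv.Perm (Fin n)) (X : Tensor n c) :
    sumPairs n c (permute g X) = sumPairs n c X :=
  Equiv.sum_comp ((g⁻¹).prodCongr g⁻¹ : Fin n × Fin n ≃ Fin n × Fin n) fun p : Fin n × Fin n => X p.1 p.2

/-- If no network separates two tensors, then any features computed from them by blocks have equal
histograms. -/
theorem exists_equiv_of_forall_eval_eq {σ : ℝ → ℝ} (hσ : Continuous σ)
    (hσ' : ¬ ∃ s t : ℝ, ∀ x, σ x = s * x + t) {n a c : ℕ} (X X' : Tensor n a)
    (h : ∀ (b : ℕ) (F : Network n a b), F.eval σ X = F.eval σ X') (Bs : Blocks a c) :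
    ∃ π : Fin n × Fin n ≃ Fin n × Fin n, ∀ p,
      Bs.eval σ X p.1 p.2 = Bs.eval σ X' (π p).1 (π p).2 := by
  classical
  refine exists_equiv_of_card_fiber_eq (f := fun p : Fin n × Fin n => Bs.eval σ X p.1 p.2)
    (g := fun p : Fin n × Fin n => Bs.eval σ X' p.1 p.2) fun x => ?_
  let A : Finset (Fin c → ℝ) := (Finset.univ.image fun p : Fin n × Fin n => Bs.eval σ X p.1 p.2) ∪
    Finset.univ.image fun p : Fin n × Fin n => Bs.eval σ X' p.1 p.2
  obtain ⟨M, hM⟩ := MLP.exists_eval_eq hσ hσ' A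
    fun y (_ : Fin 1) => if y = x then (1 : ℝ) else 0
  -- The skip connection alone carries the indicator of the value `x`; summing over pairs yields the
  -- size of its fibre.
  let B : Block c 0 1 := ⟨.output 0 0, .output 0 0, M⟩
  let F : Network n a (1 + 0) := ⟨_, _, Bs.snoc B, sumPairs n _, sumPairs_permute, MLP.id _⟩
  have hF : ∀ Y : Tensor n a, (∀ p : Fin n × Fin n, Bs.eval σ Y p.1 p.2 ∈ A) →
      F.eval σ Y (Fin.castAdd 0 0) =
        ((Finset.univ.filter fun p : Fin n × Fin n => Bs.eval σ Y p.1 p.2 = x).card : ℝ) := by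
    intro Y hY
    simp only [Network.eval, F, MLP.eval_id, Blocks.eval_snoc, sumPairs, LinearMap.coe_mk,
      AddHom.coe_mk, Finset.sum_apply, Block.eval, Fin.append_left, B]
    rw [Finset.card_filter]
    push_cast
    exact Finset.sum_congr rfl fun p _ => congrFun (hM _ (hY p)) 0
  have h1 := hF X fun p => Finset.mem_union_left _ (Finset.mem_image.2 ⟨p, Finset.mem_univ _, rfl⟩)
  have h2 := hF X' fun p => Finset.mem_union_right _ (Finset.mem_image.2 ⟨p, Finset.mem_univ _, rfl⟩)
  rw [h _ F, h2] at h1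
  exact_mod_cast h1.symm

/-- The model distinguishes all graphs that 3-WL distinguishes. -/
theorem exists_network_eval_ne {σ : ℝ → ℝ} (hσ : Continuous σ)
    (hσ' : ¬ ∃ s t : ℝ, ∀ x, σ x = s * x + t) {n e : ℕ} {V V' : Type*} [Fintype V] [Fintype V']
    {G : ColoredGraph V (Fin e → ℝ)} {G' : ColoredGraph V' (Fin e → ℝ)} (ν : Fin n ≃ V)
    (ν' : Fin n ≃ V') (hG : WLDistinguishes 3 G G') :
    ∃ (b : ℕ) (F : Network n (e + 2) b),
      F.eval σ (inputTensor G ν) ≠ F.eval σ (inputTensor G' ν') := by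
  by_contra! hcon
  obtain ⟨c, Bs, hBs⟩ := exists_stable_blocks hσ hσ' (inputTensor G ν) (inputTensor G' ν') (by
    intro u v u' v' h
    rw [inputTensor_eq_iff] at h ⊢
    refine ⟨by rw [eq_comm, h.1, eq_comm], by rw [SimpleGraph.adj_comm, h.2.1, SimpleGraph.adj_comm],
      fun hvu => ?_⟩
    rw [hvu, h.2.2 hvu.symm, h.1.1 hvu.symm])
  obtain ⟨π, hπ⟩ := exists_equiv_of_forall_eval_eq hσ hσ' _ _ hcon Bs
  let R (u v : V) (u' v' : V') : Prop :=
    Bs.eval σ (inputTensor G ν) (ν.symm u) (ν.symm v) =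
      Bs.eval σ (inputTensor G' ν') (ν'.symm u') (ν'.symm v')
  have hR : StableRel G G' R :=
    { symm := fun h => (hBs _ _ _ _ h).2.1
      stable := fun h => by
        obtain ⟨ρ, hρ⟩ := (hBs _ _ _ _ h).2.2
        exact ⟨ν.symm.trans (ρ.trans ν'), fun w => by simpa [R] using hρ (ν.symm w)⟩
      eq_iff := fun h => by simpa using (inputTensor_eq_iff.1 (hBs _ _ _ _ h).1).1
      adj_iff := fun h => by simpa using (inputTensor_eq_iff.1 (hBs _ _ _ _ h).1).2.1
      color_eq := fun h => by simpa using (inputTensor_eq_iff.1 (hBs _ _ _ _ h).1).2.2 }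
  refine hR.not_wlDistinguishes
    ((Equiv.prodCongr ν ν).symm.trans (π.trans (Equiv.prodCongr ν' ν'))) (fun p => ?_) hG
  simpa [R, Prod.map] using hπ (ν.symm p.1, ν.symm p.2)

end WLNet

theorem theorem2 (σ : ℝ → ℝ) (hσ_cont : Continuous σ)
    (hσ_nonaffine : ¬ ∃ s t : ℝ, ∀ x, σ x = s * x + t)
    (n e : ℕ) {V V' : Type*} [Fintype V] [Fintype V']
    (hV : Fintype.card V = n) (hV' : Fintype.card V' = n)
    (G : WLNet.ColoredGraph V (Fin e → ℝ)) (G' : WLNet.ColoredGraph V' (Fin e → ℝ)) :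
    -- the model distinguishes any two graphs that 3-WL distinguishes
    (WLNet.WLDistinguishes 3 G G' →
      ∃ (b : ℕ) (F : WLNet.Network n (e + 2) b), ∀ (ν : Fin n ≃ V) (ν' : Fin n ≃ V'),
        F.eval σ (WLNet.inputTensor G ν) ≠ F.eval σ (WLNet.inputTensor G' ν')) ∧
    -- every network assigns equal outputs to isomorphic graphs
    (G.Isomorphic G' →
      ∀ (b : ℕ) (F : WLNet.Network n (e + 2) b) (ν : Fin n ≃ V) (ν' : Fin n ≃ V'),
        F.eval σ (WLNet.inputTensor G ν) = F.eval σ (WLNet.inputTensor G' ν')) ∧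
    -- every network is invariant
    (∀ (a b : ℕ) (F : WLNet.Network n a b) (g : Equiv.Perm (Fin n)) (X : WLNet.Tensor n a),
      F.eval σ (WLNet.permute g X) = F.eval σ X) := by
  refine ⟨fun h => ?_, fun h b F ν ν' => F.eval_inputTensor_eq σ h ν ν',
    fun a b F g X => F.eval_permute σ g X⟩
  -- Separating one choice of enumerations suffices, since another enumeration does not change the
  -- output of a network.
  let ν₀ := (Fintype.equivFinOfCardEq hV).symm
  let ν₀' := (Fintype.equivFinOfCardEq hV').symm
  obtain ⟨b, F, hF⟩ := WLNet.exists_network_eval_ne hσ_cont hσ_nonaffine ν₀ ν₀' h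
  refine ⟨b, F, fun ν ν' => ?_⟩
  rwa [F.eval_inputTensor_eq σ (WLNet.ColoredGraph.Isomorphic.refl G) ν ν₀,
    F.eval_inputTensor_eq σ (WLNet.ColoredGraph.Isomorphic.refl G') ν' ν₀']
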